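/- Conventions. A tensor-triangulated category is an essentially small triangulated category $\mathcal T$ with a symmetric monoidal structure $(\otimes,\mathbf 1)$ that is exact in each variable, i.e. each $x\otimes -$ commutes with the shift, by isomorphisms natural in both variables, and preserves exact triangles. Its spectrum $\operatorname{Spc}\mathcal T$ is the set of prime thick $\otimes$-ideals: proper full triangulated subcategories $\mathcal P\subsetneq\mathcal T$ that are closed under direct summands and under tensoring with arbitrary objects, and such that $x\otimes y\in\mathcal P$ implies $x\in\mathcal P$ or $y\in\mathcal P$. The sets $U(x)=\{\mathcal P\mid x\in\mathcal P\}$, $x\in\mathcal T$, form a basis of open subsets of its topology. A central 2-ring of $\mathcal T$ is a full tensor subcategory $\mathcal R\subseteq\mathcal T$ (containing $\mathbf 1$ and closed under $\otimes$) which consists of $\otimes$-invertible objects and is closed under taking duals. A homogeneous ideal $\mathcal I$ of $\mathcal R$ is a family of subgroups $\mathcal I(g,h)\subseteq\mathcal R(g,h)$ closed under composing and under tensoring, on either side, with arbitrary morphisms of $\mathcal R$. It is prime if it is proper and $r\circ s\in\mathcal I$ implies $r\in\mathcal I$ or $s\in\mathcal I$. The spectrum $\operatorname{Spec}\mathcal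 R$ is the set of prime homogeneous ideals, with closed subsets the sets $V(\mathcal I)=\{\mathfrak p\mid\mathcal I\subseteq\mathfrak p\}$ for homogeneous ideals $\mathcal I$. A continuous map is spectral if preimages of quasi-compact open subsets are quasi-compact open. Theorem. For every central 2-ring $\mathcal R$ of a tensor-triangulated category $\mathcal T$ there is a spectral continuous map $\rho^{\mathcal R}_{\mathcal T}\colon\operatorname{Spc}\mathcal T\to\operatorname{Spec}\mathcal R$ which sends the prime thick $\otimes$-ideal $\mathcal P$ to the prime homogeneous ideal $$\rho^{\mathcal R}_{\mathcal T}(\mathcal P)=\{r\in\operatorname{Mor}\mathcal R\mid\operatorname{cone}(r)\notin\mathcal P\}.$$ Moreover, this map is natural in the following sense: if $F\colon\mathcal T\to\mathcal T'$ is a tensor-exact functor (an exact strong symmetric monoidal functor) between tensor-triangulated categories, and $\mathcal R'$ is a central 2-ring of $\mathcal T'$ such that $F\mathcal R\subseteq\mathcal R'$, then the maps $\operatorname{Spc}F\colon\operatorname{Spc}\mathcal T'\to\operatorname{Spc}\mathcal T$, $\mathcal P\mapsto F^{-1}\mathcal P$, and $\operatorname{Spec}F\colon\operatorname{Spec}\mathcal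 R'\to\operatorname{Spec}\mathcal R$, $\mathfrak p\mapsto F^{-1}\mathfrak p$, are spectral continuous, and $$\rho^{\mathcal R}_{\mathcal T}\circ\operatorname{Spc}F=\operatorname{Spec}F\circ\rho^{\mathcal R'}_{\mathcal T'}.$$ -/

import Mathlib

open CategoryTheory CategoryTheory.Limits CategoryTheory.MonoidalCategory
open CategoryTheory.Pretriangulated

universe v u v' u'

namespace TTGeometry

section TwoRings

variable (C : Type u) [Category.{v} C] [Preadditive C] [MonoidalCategory C]

/-- A graded commutative 2-ring: a symmetric monoidal preadditive category with additive tensor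
product in which every object is tensor-invertible. It is graded by its own Picard 2-group of
invertible objects and isomorphisms, so that the grading is no extra datum. (Every category of
types is equivalent to a small one in a suitable universe, so that essential smallness is
automatic.) -/
class GradedCommTwoRing [SymmetricCategory C] : Prop extends MonoidalPreadditive C where
  exists_inverse : ∀ g : C, ∃ g' : C, Nonempty (g ⊗ g' ≅ 𝟙_ C)

/-- A homogeneous ideal: subgroups `I(g, h) ⊆ Hom(g, h)`, closed under composition with arbitrary
morphisms on both sides and under tensoring with arbitrary morphisms on both sides. -/
@[ext]
structure HomogeneousIdeal where
  hom : ∀ g h : C, AddSubgroup (g ⟶ h)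
  comp_mem : ∀ {g' g h h' : C} (a : g' ⟶ g) (r : g ⟶ h) (b : h ⟶ h'),
    r ∈ hom g h → a ≫ r ≫ b ∈ hom g' h'
  tensor_mem_left : ∀ {g' h' g h : C} (s : g' ⟶ h') (r : g ⟶ h),
    r ∈ hom g h → (s ⊗ₘ r) ∈ hom (g' ⊗ g) (h' ⊗ h)
  tensor_mem_right : ∀ {g h g' h' : C} (r : g ⟶ h) (s : g' ⟶ h'),
    r ∈ hom g h → (r ⊗ₘ s) ∈ hom (g ⊗ g') (h ⊗ h')

/-- The points of the spectrum of a 2-ring: the prime homogeneous ideals, i.e. the proper ones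
such that `s ∘ r ∈ p` implies `r ∈ p` or `s ∈ p`. -/
@[ext]
structure Spec extends HomogeneousIdeal C where
  proper : ∃ (g h : C) (r : g ⟶ h), r ∉ hom g h
  mem_or_mem : ∀ {g h l : C} (r : g ⟶ h) (s : h ⟶ l),
    r ≫ s ∈ hom g l → r ∈ hom g h ∨ s ∈ hom h l

variable {C}

/-- The closed set `V(I)` of all primes containing the homogeneous ideal `I`. -/
def zeroLocus (I : HomogeneousIdeal C) : Set (Spec C) :=
  {p | ∀ g h : C, I.hom g h ≤ p.hom g h}

/-- The intersection of a family of homogeneous ideals. -/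
def HomogeneousIdeal.sInf (S : Set (HomogeneousIdeal C)) : HomogeneousIdeal C where
  hom g h := ⨅ I ∈ S, I.hom g h
  comp_mem a r b hr := by
    simp only [AddSubgroup.mem_iInf] at hr ⊢
    exact fun I hI => I.comp_mem a r b (hr I hI)
  tensor_mem_left s r hr := by
    simp only [AddSubgroup.mem_iInf] at hr ⊢
    exact fun I hI => I.tensor_mem_left s r (hr I hI)
  tensor_mem_right r s hr := by
    simp only [AddSubgroup.mem_iInf] at hr ⊢
    exact fun I hI => I.tensor_mem_right r s (hr I hI)

theorem HomogeneousIdeal.mem_sInf {S : Set (HomogeneousIdeal C)} {g h : C} {r : g ⟶ h} :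
    r ∈ (HomogeneousIdeal.sInf S).hom g h ↔ ∀ I ∈ S, r ∈ I.hom g h := by
  simp [HomogeneousIdeal.sInf, AddSubgroup.mem_iInf]

theorem HomogeneousIdeal.comp_left_mem (I : HomogeneousIdeal C) {g' g h : C} (a : g' ⟶ g)
    {r : g ⟶ h} (hr : r ∈ I.hom g h) : a ≫ r ∈ I.hom g' h := by
  simpa using I.comp_mem a r (𝟙 h) hr

theorem HomogeneousIdeal.comp_right_mem (I : HomogeneousIdeal C) {g h h' : C}
    {r : g ⟶ h} (b : h ⟶ h') (hr : r ∈ I.hom g h) : r ≫ b ∈ I.hom g h' := by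
  simpa using I.comp_mem (𝟙 g) r b hr

theorem HomogeneousIdeal.whiskerLeft_mem (I : HomogeneousIdeal C) (k : C) {g h : C}
    {r : g ⟶ h} (hr : r ∈ I.hom g h) : k ◁ r ∈ I.hom (k ⊗ g) (k ⊗ h) := by
  simpa using I.tensor_mem_left (𝟙 k) r hr

theorem HomogeneousIdeal.whiskerRight_mem (I : HomogeneousIdeal C) {g h : C}
    {r : g ⟶ h} (k : C) (hr : r ∈ I.hom g h) : r ▷ k ∈ I.hom (g ⊗ k) (h ⊗ k) := by
  simpa using I.tensor_mem_right r (𝟙 k) hr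

/-- An ideal that contains the identity of the unit contains everything. -/
theorem HomogeneousIdeal.mem_of_unit_mem (I : HomogeneousIdeal C)
    (hI : 𝟙 (𝟙_ C) ∈ I.hom (𝟙_ C) (𝟙_ C)) {g h : C} (r : g ⟶ h) : r ∈ I.hom g h := by
  have h1 := I.comp_mem (λ_ g).inv _ ((λ_ g).hom ≫ r) (I.whiskerRight_mem g hI)
  simpa using h1

variable [SymmetricCategory C] [GradedCommTwoRing C]

/-- Since objects are invertible, an ideal that contains a left twist of `r` contains `r`. -/
theorem HomogeneousIdeal.mem_of_whiskerLeft_mem (I : HomogeneousIdeal C) (k : C) {g h : C}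
    {r : g ⟶ h} (hr : k ◁ r ∈ I.hom (k ⊗ g) (k ⊗ h)) : r ∈ I.hom g h := by
  obtain ⟨k', ⟨e⟩⟩ := GradedCommTwoRing.exists_inverse k
  let e' : k' ⊗ k ≅ 𝟙_ C := β_ k' k ≪≫ e
  have h1 := I.comp_mem ((λ_ g).inv ≫ e'.inv ▷ g ≫ (α_ k' k g).hom) _
    ((α_ k' k h).inv ≫ e'.hom ▷ h ≫ (λ_ h).hom) (I.whiskerLeft_mem k' hr)
  have h2 : ((λ_ g).inv ≫ e'.inv ▷ g ≫ (α_ k' k g).hom) ≫ (k' ◁ (k ◁ r)) ≫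
      ((α_ k' k h).inv ≫ e'.hom ▷ h ≫ (λ_ h).hom) = r := by
    have h3 : (α_ k' k g).hom ≫ k' ◁ (k ◁ r) ≫ (α_ k' k h).inv = (k' ⊗ k) ◁ r := by simp
    calc _ = (λ_ g).inv ≫ e'.inv ▷ g ≫
          ((α_ k' k g).hom ≫ k' ◁ (k ◁ r) ≫ (α_ k' k h).inv) ≫ e'.hom ▷ h ≫ (λ_ h).hom := by
          simp only [Category.assoc]
      _ = (λ_ g).inv ≫ e'.inv ▷ g ≫ (k' ⊗ k) ◁ r ≫ e'.hom ▷ h ≫ (λ_ h).hom := by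
          rw [h3]
      _ = r := by
          rw [← whisker_exchange_assoc, ← comp_whiskerRight_assoc, e'.inv_hom_id]
          simp
  rwa [h2] at h1

/-- The Zariski topology: the closed subsets are exactly the sets `V(I)`. -/
instance zariskiTopology : TopologicalSpace (Spec C) :=
  TopologicalSpace.ofClosed {Z | ∃ I : HomogeneousIdeal C, Z = zeroLocus I}
    (by
      refine ⟨⟨fun g h => ⊤, fun _ _ _ _ => trivial, fun _ _ _ => trivial,
        fun _ _ _ => trivial⟩, ?_⟩
      symm
      rw [Set.eq_empty_iff_forall_notMem]
      intro p hp
      obtain ⟨g, h, r, hr⟩ := p.proper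
      exact hr (hp g h trivial))
    (by
      intro A hA
      refine ⟨HomogeneousIdeal.sInf {J | ∀ I, zeroLocus I ∈ A → ∀ g h, I.hom g h ≤ J.hom g h},
        ?_⟩
      ext p
      constructor
      · intro hp g h r hr
        rw [HomogeneousIdeal.mem_sInf] at hr
        exact hr p.toHomogeneousIdeal (fun I hI => hp _ hI)
      · intro hp Z hZ
        obtain ⟨I, rfl⟩ := hA hZ
        intro g h r hr
        refine hp g h ?_
        rw [HomogeneousIdeal.mem_sInf]
        exact fun J hJ => hJ I hZ g h hr)
    (by
      rintro _ ⟨I, rfl⟩ _ ⟨J, rfl⟩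
      refine ⟨HomogeneousIdeal.sInf {I, J}, ?_⟩
      ext p
      constructor
      · intro hp g h r hr
        rw [HomogeneousIdeal.mem_sInf] at hr
        rcases hp with hp | hp
        · exact hp g h (hr I (by simp))
        · exact hp g h (hr J (by simp))
      · intro hp
        by_contra hcon
        rw [Set.mem_union, not_or] at hcon
        obtain ⟨hI, hJ⟩ := hcon
        simp only [zeroLocus, Set.mem_ofPred_eq, not_forall, SetLike.not_le_iff_exists] at hI hJ
        obtain ⟨g, h, r, hr, hrp⟩ := hI
        obtain ⟨k, l, s, hs, hsp⟩ := hJ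
        have h1 : (g ◁ s) ≫ (r ▷ l) ∈ p.hom (g ⊗ k) (h ⊗ l) := by
          refine hp _ _ ?_
          rw [HomogeneousIdeal.mem_sInf]
          intro K hK
          rcases hK with rfl | rfl
          · exact K.comp_left_mem _ (K.whiskerRight_mem l hr)
          · exact K.comp_right_mem _ (K.whiskerLeft_mem g hs)
        rcases p.mem_or_mem _ _ h1 with h2 | h2
        · exact hsp (p.mem_of_whiskerLeft_mem g h2)
        · refine hrp (p.mem_of_whiskerLeft_mem l ?_)
          have h3 := p.comp_mem (β_ l g).hom _ (β_ l h).inv h2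
          rwa [← BraidedCategory.braiding_naturality_right_assoc, Iso.hom_inv_id,
            Category.comp_id] at h3)

theorem isClosed_iff_exists_zeroLocus (Z : Set (Spec C)) :
    IsClosed Z ↔ ∃ I : HomogeneousIdeal C, Z = zeroLocus I := by
  rw [← isOpen_compl_iff]
  change Zᶜᶜ ∈ _ ↔ _
  rw [compl_compl]
  rfl

end TwoRings

section SpecMap

variable {C : Type u} [Category.{v} C] [Preadditive C] [MonoidalCategory C]
  {D : Type u'} [Category.{v'} D] [Preadditive D] [MonoidalCategory D]

/-- The map `Spec F : Spec D → Spec C`, `p ↦ F⁻¹ p`, induced by an additive (strong) monoidal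
functor `F : C ⥤ D`. -/
def Spec.map (F : C ⥤ D) [F.Additive] [F.Monoidal] (p : Spec D) : Spec C where
  hom g h := (p.hom (F.obj g) (F.obj h)).comap (F.mapAddHom (X := g) (Y := h))
  comp_mem a r b hr := by
    simp only [AddSubgroup.mem_comap, Functor.coe_mapAddHom, Functor.map_comp] at hr ⊢
    exact p.comp_mem _ _ _ hr
  tensor_mem_left s r hr := by
    simp only [AddSubgroup.mem_comap, Functor.coe_mapAddHom] at hr ⊢
    rw [Functor.Monoidal.map_tensor]
    exact p.comp_mem _ _ _ (p.tensor_mem_left _ _ hr)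
  tensor_mem_right r s hr := by
    simp only [AddSubgroup.mem_comap, Functor.coe_mapAddHom] at hr ⊢
    rw [Functor.Monoidal.map_tensor]
    exact p.comp_mem _ _ _ (p.tensor_mem_right _ _ hr)
  proper := by
    refine ⟨𝟙_ C, 𝟙_ C, 𝟙 _, fun hmem => ?_⟩
    simp only [AddSubgroup.mem_comap, Functor.coe_mapAddHom] at hmem
    obtain ⟨g, h, r, hr⟩ := p.proper
    refine hr (p.mem_of_unit_mem ?_ r)
    have h1 := p.comp_mem (Functor.Monoidal.εIso F).hom _ (Functor.Monoidal.εIso F).inv hmem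
    rwa [F.map_id, Category.id_comp, Iso.hom_inv_id] at h1
  mem_or_mem r s hrs := by
    simp only [AddSubgroup.mem_comap, Functor.coe_mapAddHom, Functor.map_comp] at hrs ⊢
    exact p.mem_or_mem _ _ hrs

end SpecMap

section Cone

variable {T : Type u} [Category.{v} T] [Preadditive T] [HasZeroObject T] [HasShift T ℤ]
  [∀ n : ℤ, (shiftFunctor T n).Additive] [Pretriangulated T]

/-- The cone of a morphism `f : x ⟶ y`: the third object of a
distinguished triangle `x ⟶ y ⟶ cone f ⟶ x⟦1⟧`, unique up to (non-canonical) isomorphism. -/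
noncomputable def cone {x y : T} (f : x ⟶ y) : T :=
  (distinguished_cocone_triangle f).choose

theorem cone_distinguished {x y : T} (f : x ⟶ y) :
    ∃ (g : y ⟶ cone f) (h : cone f ⟶ x⟦(1 : ℤ)⟧), Triangle.mk f g h ∈ distTriang T :=
  (distinguished_cocone_triangle f).choose_spec

end Cone

section Dual

variable {T : Type u} [Category.{v} T] [MonoidalCategory T] [SymmetricCategory T]

/-- A dual of an invertible object is an inverse of it. -/
theorem nonempty_tensor_dual_iso_unit {g k d : T} (e : g ⊗ k ≅ 𝟙_ T) (hd : ExactPairing g d) :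
    Nonempty (g ⊗ d ≅ 𝟙_ T) := by
  let e' : k ⊗ g ≅ 𝟙_ T := β_ k g ≪≫ e
  let E : T ≌ T := CategoryTheory.Equivalence.mk (tensorLeft k) (tensorLeft g)
    ((leftUnitorNatIso T).symm ≪≫ (curriedTensor T).mapIso e.symm ≪≫ tensorLeftTensor g k)
    ((tensorLeftTensor k g).symm ≪≫ (curriedTensor T).mapIso e' ≪≫ leftUnitorNatIso T)
  let i : tensorLeft d ≅ tensorLeft k :=
    Adjunction.leftAdjointUniq (tensorLeftAdjunction g d) E.toAdjunction
  let j : d ≅ k := (ρ_ d).symm ≪≫ i.app (𝟙_ T) ≪≫ ρ_ k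
  exact ⟨(tensorLeft g).mapIso j ≪≫ e⟩

end Dual

section TensorTriangulated

variable (T : Type u) [Category.{v} T] [Preadditive T] [HasZeroObject T] [HasShift T ℤ]
  [∀ n : ℤ, (shiftFunctor T n).Additive] [Pretriangulated T]
  [MonoidalCategory T] [SymmetricCategory T]

/-- A tensor-triangulated category: a triangulated category with a symmetric monoidal structure
whose tensor product is exact in each variable, that is, each functor `x ⊗ -` is equipped with
isomorphisms `x ⊗ y⟦n⟧ ≅ (x ⊗ y)⟦n⟧`, natural in `x` and `y`, by means of which it preserves
distinguished triangles. (By symmetry, the same holds for `- ⊗ x`.) -/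
class TensorTriangulated extends IsTriangulated T where
  commShift : ∀ x : T, (tensorLeft x).CommShift ℤ
  commShift_natural : ∀ {x y : T} (f : x ⟶ y),
    NatTrans.CommShift ((curriedTensor T).map f) ℤ
  isTriangulated_tensorLeft : ∀ x : T, (tensorLeft x).IsTriangulated

attribute [reducible] TensorTriangulated.commShift
attribute [instance] TensorTriangulated.commShift TensorTriangulated.commShift_natural
  TensorTriangulated.isTriangulated_tensorLeft

instance monoidalPreadditive_of_tensorTriangulated [TensorTriangulated T] :
    MonoidalPreadditive T := by
  have hz : ∀ {X Y Z : T}, X ◁ (0 : Y ⟶ Z) = 0 := fun {X _ _} => (tensorLeft X).map_zero _ _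
  have ha : ∀ {X Y Z : T} (f g : Y ⟶ Z), X ◁ (f + g) = X ◁ f + X ◁ g :=
    fun {X _ _} _ _ => (tensorLeft X).map_add
  have hr : ∀ {X Y Z : T} (f : Y ⟶ Z), f ▷ X = (β_ Y X).hom ≫ X ◁ f ≫ (β_ Z X).inv :=
    fun {X _ _} f => by simp
  exact
    { whiskerLeft_zero := hz
      zero_whiskerRight := by
        intro X Y Z
        rw [hr, hz, zero_comp, comp_zero]
      whiskerLeft_add := ha
      add_whiskerRight := by
        intro X Y Z f g
        rw [hr, hr f, hr g, ha, Preadditive.add_comp, Preadditive.comp_add] }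

/-- The points of the triangular spectrum: the prime thick tensor ideals `P ⊊ T`, i.e. the proper
full triangulated subcategories closed under direct summands and under tensoring with arbitrary
objects, such that `x ⊗ y ∈ P` implies `x ∈ P` or `y ∈ P`. -/
@[ext]
structure Spc where
  obj : ObjectProperty T
  isTriangulated : obj.IsTriangulated
  thick : obj.IsStableUnderRetracts
  tensor_mem : ∀ x y : T, obj y → obj (x ⊗ y)
  proper : ∃ x : T, ¬ obj x
  mem_or_mem : ∀ x y : T, obj (x ⊗ y) → obj x ∨ obj y

/-- The topology on `Spc T` that has the sets `U(x) = {P | x ∈ P}` as a basis of open subsets,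
i.e. the supports `supp(x) = {P | x ∉ P}` as a basis of closed subsets. -/
instance spcTopology : TopologicalSpace (Spc T) :=
  TopologicalSpace.generateFrom {U | ∃ x : T, U = {P : Spc T | P.obj x}}

variable {T}

/-- A central 2-ring of `T`: a full tensor subcategory, given by its class of objects, consisting
of invertible objects and closed under taking duals. It need not be closed under isomorphism, and
closure under duals means that each object has a dual which lies in the subcategory. -/
class IsCentralTwoRing (R : ObjectProperty T) : Prop extends R.IsMonoidal where
  invertible : ∀ g : T, R g → ∃ g' : T, Nonempty (g ⊗ g' ≅ 𝟙_ T)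
  exists_dual : ∀ g : T, R g → ∃ g' : T, R g' ∧ Nonempty (ExactPairing g g')

/-- Every central 2-ring is a graded commutative 2-ring. -/
instance gradedCommTwoRing_of_isCentralTwoRing [TensorTriangulated T] (R : ObjectProperty T)
    [IsCentralTwoRing R] : GradedCommTwoRing R.FullSubcategory where
  exists_inverse g := by
    obtain ⟨k, ⟨e⟩⟩ := IsCentralTwoRing.invertible (R := R) g.obj g.property
    obtain ⟨d, hd, ⟨p⟩⟩ := IsCentralTwoRing.exists_dual (R := R) g.obj g.property
    obtain ⟨i⟩ := nonempty_tensor_dual_iso_unit e p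
    exact ⟨⟨d, hd⟩, ⟨R.isoMk i⟩⟩

/-- The formula `ρ(P) = {r ∈ Mor R | cone(r) ∉ P}`, which determines the map `ρ`. -/
def IsComparisonMap (R : ObjectProperty T) [IsCentralTwoRing R]
    (ρ : Spc T → Spec R.FullSubcategory) : Prop :=
  ∀ (P : Spc T) (g h : R.FullSubcategory) (r : g ⟶ h),
    r ∈ (ρ P).hom g h ↔ ¬ P.obj (cone r.hom)

end TensorTriangulated

section Functoriality

variable {T : Type u} [Category.{v} T] [Preadditive T] [HasZeroObject T] [HasShift T ℤ]
  [∀ n : ℤ, (shiftFunctor T n).Additive] [Pretriangulated T]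
  [MonoidalCategory T] [SymmetricCategory T]
  {T' : Type u'} [Category.{v'} T'] [Preadditive T'] [HasZeroObject T'] [HasShift T' ℤ]
  [∀ n : ℤ, (shiftFunctor T' n).Additive] [Pretriangulated T']
  [MonoidalCategory T'] [SymmetricCategory T']

/-- The map `Spc F : Spc T' → Spc T`, `P ↦ F⁻¹ P`, induced by a tensor-exact functor, i.e. an
exact (strong) symmetric monoidal functor `F : T ⥤ T'`. -/
def Spc.map (F : T ⥤ T') [F.Braided] [F.CommShift ℤ] [F.IsTriangulated] (P : Spc T') :
    Spc T where
  obj := P.obj.inverseImage F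
  isTriangulated := by
    have := P.isTriangulated
    have := P.thick
    infer_instance
  thick := by
    have := P.thick
    exact ⟨fun h hY => P.obj.prop_of_retract (h.map F) hY⟩
  tensor_mem x y hy := by
    have := P.thick
    exact P.obj.prop_of_iso (Functor.Monoidal.μIso F x y) (P.tensor_mem _ _ hy)
  proper := by
    have := P.thick
    obtain ⟨x, hx⟩ := P.proper
    refine ⟨𝟙_ T, fun h1 => hx ?_⟩
    have h2 : P.obj (𝟙_ T') := P.obj.prop_of_iso (Functor.Monoidal.εIso F).symm h1
    exact P.obj.prop_of_iso (ρ_ x) (P.tensor_mem x _ h2)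
  mem_or_mem x y hxy := by
    have := P.thick
    exact P.mem_or_mem _ _ (P.obj.prop_of_iso (Functor.Monoidal.μIso F x y).symm hxy)

variable (R : ObjectProperty T) [R.IsMonoidal] (R' : ObjectProperty T') [R'.IsMonoidal]
  (F : T ⥤ T')

/-- The restriction `R ⥤ R'` of a functor `F : T ⥤ T'` with `F R ⊆ R'`. -/
abbrev restrict (hF : ∀ g : T, R g → R' (F.obj g)) : R.FullSubcategory ⥤ R'.FullSubcategory :=
  R'.lift (R.ι ⋙ F) fun g => hF g.obj g.property

instance restrict_additive [F.Additive] (hF : ∀ g : T, R g → R' (F.obj g)) :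
    (restrict R R' F hF).Additive where
  map_add {_ _ f g} := by
    apply ObjectProperty.hom_ext
    exact F.map_add

/-- The restriction of a monoidal functor is monoidal, with the same structure isomorphisms. -/
instance restrict_monoidal [F.Monoidal] (hF : ∀ g : T, R g → R' (F.obj g)) :
    (restrict R R' F hF).Monoidal :=
  Functor.CoreMonoidal.toMonoidal
    { εIso := R'.isoMk (Functor.Monoidal.εIso F)
      μIso := fun g h => R'.isoMk (Functor.Monoidal.μIso F g.obj h.obj)
      μIso_hom_natural_left := fun f h => by
        apply ObjectProperty.hom_ext
        exact Functor.LaxMonoidal.μ_natural_left F f.hom h.obj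
      μIso_hom_natural_right := fun h f => by
        apply ObjectProperty.hom_ext
        exact Functor.LaxMonoidal.μ_natural_right F h.obj f.hom
      associativity := fun g h k => by
        apply ObjectProperty.hom_ext
        exact Functor.LaxMonoidal.associativity F g.obj h.obj k.obj
      left_unitality := fun g => by
        apply ObjectProperty.hom_ext
        exact Functor.LaxMonoidal.left_unitality F g.obj
      right_unitality := fun g => by
        apply ObjectProperty.hom_ext
        exact Functor.LaxMonoidal.right_unitality F g.obj }

end Functoriality

end TTGeometry

/-! A morphism has its cone in `P` exactly when it becomes invertible in the Verdier quotient `T/P`,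
i.e. when it lies in `P.obj.trW`. So `ρ(P)` is the set of morphisms of `R` that stay non-invertible
modulo `P`. Composites of invertible maps are invertible, which gives primality; the work lies in
showing that `ρ(P)` is an ideal.

The key is `tensorHom_tensorHom_id_cone_eq_zero`: for `r` between invertible objects, `r ⊗ r ⊗ cone
r = 0`. It rests on the self-braiding of an invertible object being a scalar, so that `r ⊗ g` and `g
⊗ r` factor through each other up to harmless maps. If `w` factors through `r` and is inverted
modulo `P`, then `w ⊗ w ⊗ cone r` is both zero and inverted, so its source lies in `P`; when `w` has
invertible source, `cone r` lies in `P`. The same argument applied to `(r + s) ⊗ (r + s) ⊗ (r + s)`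
on `cone r ⊗ cone s`, where every term repeats `r` or `s`, handles sums. This is where primality of
`P` enters.

For the topology, an ultraproduct of primes is again a prime and is a limit of the ultrafilter, so
basic open sets are compact in both spectra. All the maps pull basic open sets back to basic open
sets, hence are spectral. Naturality holds because exact functors preserve cones. -/

namespace TTGeometry

/-! ### Spectral maps tested on a basis -/

section Topology

variable {X Y : Type*} [TopologicalSpace X] [TopologicalSpace Y]

/-- A map is spectral if the preimages of the members of some basis are compact open. -/
theorem isSpectralMap_of_isTopologicalBasis {f : X → Y} {ι : Type*} {b : ι → Set Y}
    (hb : TopologicalSpace.IsTopologicalBasis (Set.range b))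
    (ho : ∀ i, IsOpen (f ⁻¹' b i)) (hc : ∀ i, IsCompact (f ⁻¹' b i)) : IsSpectralMap f where
  toContinuous := hb.continuous_iff.2 (by rintro _ ⟨i, rfl⟩; exact ho i)
  isCompact_preimage_of_isOpen := by
    intro K hKo hKc
    obtain ⟨F, hF, rfl⟩ :=
      eq_finite_iUnion_of_isTopologicalBasis_of_isCompact_open b hb K hKc hKo
    rw [Set.preimage_iUnion₂]
    exact hF.isCompact_biUnion fun i _ => hc i

end Topology

/-! ### Invertible objects, scalars and symmetries -/

section Monoidal

variable {C : Type u} [Category.{v} C] [MonoidalCategory C]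

/-- Tensoring with an invertible object is an equivalence, hence full. -/
theorem exists_whiskerLeft_eq [SymmetricCategory C] {k k' : C} (e : k ⊗ k' ≅ 𝟙_ C) {x y : C}
    (f : k ⊗ x ⟶ k ⊗ y) : ∃ u : x ⟶ y, f = k ◁ u := by
  let e' : k' ⊗ k ≅ 𝟙_ C := β_ k' k ≪≫ e
  let E : C ≌ C := CategoryTheory.Equivalence.mk (tensorLeft k) (tensorLeft k')
    ((leftUnitorNatIso C).symm ≪≫ (curriedTensor C).mapIso e'.symm ≪≫ tensorLeftTensor k' k)
    ((tensorLeftTensor k k').symm ≪≫ (curriedTensor C).mapIso e ≪≫ leftUnitorNatIso C)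
  obtain ⟨u, hu⟩ := E.functor.map_surjective (X := x) (Y := y) f
  exact ⟨u, hu.symm⟩

/-- The action of an endomorphism of the unit on an object. -/
def unitScalar (e : 𝟙_ C ⟶ 𝟙_ C) (x : C) : x ⟶ x := (λ_ x).inv ≫ e ▷ x ≫ (λ_ x).hom

theorem unitScalar_naturality (e : 𝟙_ C ⟶ 𝟙_ C) {x y : C} (f : x ⟶ y) :
    unitScalar e x ≫ f = f ≫ unitScalar e y := by
  simp only [unitScalar, Category.assoc]
  rw [← leftUnitor_naturality, ← whisker_exchange_assoc, leftUnitor_inv_naturality_assoc]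

/-- By fullness of `k ⊗ -`, every endomorphism of `k ≅ k ⊗ 𝟙_ C` comes from one of the unit. -/
theorem exists_eq_unitScalar [SymmetricCategory C] {k k' : C} (e : k ⊗ k' ≅ 𝟙_ C) (f : k ⟶ k) :
    ∃ a : 𝟙_ C ⟶ 𝟙_ C, f = unitScalar a k := by
  obtain ⟨a, ha⟩ := exists_whiskerLeft_eq e ((ρ_ k).hom ≫ f ≫ (ρ_ k).inv)
  refine ⟨a, ?_⟩
  have h : f = (ρ_ k).inv ≫ k ◁ a ≫ (ρ_ k).hom := by simp [← ha]
  rw [h, unitScalar, ← braiding_leftUnitor, BraidedCategory.braiding_naturality_right_assoc,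
    rightUnitor_inv_braiding_assoc]

/-- The self-braiding of an invertible object is the action of a scalar. -/
theorem exists_braiding_eq_whiskerLeft_unitScalar [SymmetricCategory C] {k k' : C}
    (e : k ⊗ k' ≅ 𝟙_ C) : ∃ a : 𝟙_ C ⟶ 𝟙_ C, (β_ k k).hom = k ◁ unitScalar a k := by
  obtain ⟨u, hu⟩ := exists_whiskerLeft_eq e (β_ k k).hom
  obtain ⟨a, ha⟩ := exists_eq_unitScalar e u
  exact ⟨a, by rw [hu, ha]⟩

variable [SymmetricCategory C]

/-- Naturality of the braiding relates the two whiskerings up to the self-braiding of `g`. That is a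
scalar, so it slides past `r` and can be absorbed into `ψ`. The next lemma is the mirror image, with
the scalar coming from the target of `r`. -/
theorem exists_whiskerRight_eq_whiskerLeft_comp {g h g' : C} (e : g ⊗ g' ≅ 𝟙_ C) (r : g ⟶ h) :
    ∃ ψ : g ⊗ h ⟶ h ⊗ g, r ▷ g = g ◁ r ≫ ψ := by
  obtain ⟨a, ha⟩ := exists_braiding_eq_whiskerLeft_unitScalar e
  refine ⟨g ◁ unitScalar a h ≫ (β_ g h).hom, ?_⟩
  rw [← MonoidalCategory.whiskerLeft_comp_assoc, ← unitScalar_naturality,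
    MonoidalCategory.whiskerLeft_comp_assoc, ← ha, BraidedCategory.braiding_naturality_right,
    SymmetricCategory.symmetry_assoc]

theorem exists_whiskerRight_eq_comp_whiskerLeft {g h h' : C} (e : h ⊗ h' ≅ 𝟙_ C) (r : g ⟶ h) :
    ∃ ψ : g ⊗ h ⟶ h ⊗ g, r ▷ h = ψ ≫ h ◁ r := by
  obtain ⟨a, ha⟩ := exists_braiding_eq_whiskerLeft_unitScalar e
  refine ⟨(β_ g h).hom ≫ h ◁ unitScalar a g, ?_⟩
  rw [Category.assoc, ← MonoidalCategory.whiskerLeft_comp, unitScalar_naturality,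
    MonoidalCategory.whiskerLeft_comp, ← ha, BraidedCategory.braiding_naturality_right,
    SymmetricCategory.symmetry_assoc]

/-- The symmetry exchanges the first two factors, so vanishing of a tensor product of morphisms does
not depend on their order; this is the form used below. -/
theorem exists_tensorHom_left_comm {x y x' y' z w : C} (a : x ⟶ y) (b : x' ⟶ y') (c : z ⟶ w) :
    ∃ (φ : x' ⊗ (x ⊗ z) ⟶ x ⊗ (x' ⊗ z)) (ψ : y ⊗ (y' ⊗ w) ⟶ y' ⊗ (y ⊗ w)),
      b ⊗ₘ (a ⊗ₘ c) = φ ≫ (a ⊗ₘ (b ⊗ₘ c)) ≫ ψ := by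
  refine ⟨(α_ _ _ _).inv ≫ (β_ x x').inv ▷ z ≫ (α_ _ _ _).hom,
    (α_ _ _ _).inv ≫ (β_ y y').hom ▷ w ≫ (α_ _ _ _).hom, ?_⟩
  have h1 : (β_ x x').hom ▷ z ≫ ((b ⊗ₘ a) ⊗ₘ c) = ((a ⊗ₘ b) ⊗ₘ c) ≫ (β_ y y').hom ▷ w := by
    rw [← tensorHom_id, ← tensorHom_id, tensorHom_comp_tensorHom, tensorHom_comp_tensorHom,
      BraidedCategory.braiding_naturality]
    simp
  rw [Category.assoc, Category.assoc, ← associator_naturality_assoc, Iso.hom_inv_id_assoc,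
    ← reassoc_of% h1, associator_naturality, inv_hom_whiskerRight_assoc, Iso.inv_hom_id_assoc]

theorem tensorHom_left_comm_eq_zero [HasZeroMorphisms C] {x y x' y' z w : C} {a : x ⟶ y}
    {b : x' ⟶ y'} {c : z ⟶ w} (h : a ⊗ₘ (b ⊗ₘ c) = 0) : b ⊗ₘ (a ⊗ₘ c) = 0 := by
  obtain ⟨φ, ψ, h1⟩ := exists_tensorHom_left_comm a b c
  rw [h1, h, zero_comp, comp_zero]

theorem tensorHom_tensorHom_left_comm_eq_zero [HasZeroMorphisms C] {x y x' y' z w k l : C}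
    {a : x ⟶ y} {b : x' ⟶ y'} {c : z ⟶ w} {d : k ⟶ l} (h : d ⊗ₘ (a ⊗ₘ (b ⊗ₘ c)) = 0) :
    d ⊗ₘ (b ⊗ₘ (a ⊗ₘ c)) = 0 := by
  obtain ⟨φ, ψ, h1⟩ := exists_tensorHom_left_comm a b c
  have h2 : d ⊗ₘ (b ⊗ₘ (a ⊗ₘ c)) = k ◁ φ ≫ (d ⊗ₘ (a ⊗ₘ (b ⊗ₘ c))) ≫ l ◁ ψ := by
    rw [h1, ← id_tensorHom, ← id_tensorHom, tensorHom_comp_tensorHom, tensorHom_comp_tensorHom,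
      Category.id_comp, Category.comp_id]
  rw [h2, h, zero_comp, comp_zero]

end Monoidal

/-! ### Exactness of the tensor product and nilpotence on cones -/

section Triangulated

variable {T : Type u} [Category.{v} T] [Preadditive T] [HasZeroObject T] [HasShift T ℤ]
  [∀ n : ℤ, (shiftFunctor T n).Additive] [Pretriangulated T]
  [MonoidalCategory T] [TensorTriangulated T]

/-- This is the naturality in `x` of the isomorphisms `x ⊗ z⟦1⟧ ≅ (x ⊗ z)⟦1⟧`. -/
theorem whiskerRight_shift_eq (x y z : T) (f : x ⟶ y) :
    f ▷ (z⟦(1 : ℤ)⟧) = ((tensorLeft x).commShiftIso (1 : ℤ)).hom.app z ≫ (f ▷ z)⟦(1 : ℤ)⟧' ≫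
      ((tensorLeft y).commShiftIso (1 : ℤ)).inv.app z := by
  have h := NatTrans.shift_app_comm ((curriedTensor T).map f) (1 : ℤ) z
  have h' : f ▷ (z⟦(1 : ℤ)⟧) ≫ ((tensorLeft y).commShiftIso (1 : ℤ)).hom.app z =
    ((tensorLeft x).commShiftIso (1 : ℤ)).hom.app z ≫ (f ▷ z)⟦(1 : ℤ)⟧' := h.symm
  rw [← reassoc_of% h']
  simp

theorem whiskerLeft_shift_eq (x y z : T) (f : y ⟶ z) :
    (x ◁ f)⟦(1 : ℤ)⟧' = ((tensorLeft x).commShiftIso (1 : ℤ)).inv.app y ≫ x ◁ (f⟦(1 : ℤ)⟧') ≫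
      ((tensorLeft x).commShiftIso (1 : ℤ)).hom.app z := by
  have h : x ◁ (f⟦(1 : ℤ)⟧') ≫ ((tensorLeft x).commShiftIso (1 : ℤ)).hom.app z =
      ((tensorLeft x).commShiftIso (1 : ℤ)).hom.app y ≫ (x ◁ f)⟦(1 : ℤ)⟧' :=
    (tensorLeft x).commShiftIso_hom_naturality f 1
  rw [h]
  simp

/-- The square of a morphism between invertible objects acts as zero on its cone. -/
theorem tensorHom_tensorHom_id_cone_eq_zero [SymmetricCategory T] {g h g' h' : T}
    (eg : g ⊗ g' ≅ 𝟙_ T) (eh : h ⊗ h' ≅ 𝟙_ T) (r : g ⟶ h) : r ⊗ₘ (r ⊗ₘ 𝟙 (cone r)) = 0 := by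
  obtain ⟨i, j, hT⟩ := cone_distinguished r
  have hri : r ≫ i = 0 := comp_distTriang_mor_zero₁₂ _ hT
  have hjr : j ≫ r⟦(1 : ℤ)⟧' = 0 := comp_distTriang_mor_zero₃₁ _ hT
  -- After exchanging the factors, `r ▷ h` can be replaced by a map ending in `h ◁ r`, and `r ≫ i =
  -- 0`.
  have h1 : g ◁ i ≫ r ▷ cone r = 0 := by
    obtain ⟨ψ, hψ⟩ := exists_whiskerRight_eq_comp_whiskerLeft eh r
    rw [whisker_exchange, hψ, Category.assoc, ← MonoidalCategory.whiskerLeft_comp, hri]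
    simp
  -- Dually, `r ▷ g⟦1⟧` is a shift of `r ▷ g`, which begins with `g ◁ r`, and `j` composed with the
  -- shift of `r` is zero.
  have h2 : g ◁ j ≫ r ▷ (g⟦(1 : ℤ)⟧) = 0 := by
    obtain ⟨ψ, hψ⟩ := exists_whiskerRight_eq_whiskerLeft_comp eg r
    rw [whiskerRight_shift_eq, hψ, Functor.map_comp, whiskerLeft_shift_eq]
    have h3 : g ◁ j ≫ g ◁ r⟦(1 : ℤ)⟧' = 0 := by
      rw [← MonoidalCategory.whiskerLeft_comp, hjr, MonoidalPreadditive.whiskerLeft_zero]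
    simp only [Category.assoc]
    erw [Iso.hom_inv_id_app_assoc]
    rw [reassoc_of% h3]
    simp
  -- By `h1`, exactness of the triangle tensored with `g` makes `r ▷ cone r` factor through its
  -- connecting map. The second factor `r` then kills `g ◁ j`, by `h2` and a swap of factors.
  obtain ⟨φ, hφ⟩ := Triangle.yoneda_exact₃ _ ((tensorLeft g).map_distinguished _ hT)
    (r ▷ cone r) h1
  have h4 : r ▷ cone r = g ◁ j ≫ ((tensorLeft g).commShiftIso (1 : ℤ)).hom.app g ≫ φ := by
    rw [hφ]; exact Category.assoc _ _ _
  have h5 : r ⊗ₘ (g ◁ j) = 0 := by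
    have : r ⊗ₘ (𝟙 g ⊗ₘ j) = 0 := tensorHom_left_comm_eq_zero (by
      rw [id_tensorHom, tensorHom_def', h2]; simp)
    simpa using this
  have h6 : r ⊗ₘ (r ▷ cone r) = (r ⊗ₘ (g ◁ j)) ≫
      h ◁ (((tensorLeft g).commShiftIso (1 : ℤ)).hom.app g ≫ φ) := by
    rw [h4, ← id_tensorHom h, tensorHom_comp_tensorHom]
    simp
  rw [tensorHom_id, h6, h5, zero_comp]

end Triangulated

/-! ### Compact basic open sets of the spectrum of a 2-ring -/

section Spectrum

open Filter

variable {C : Type u} [Category.{v} C] [Preadditive C] [MonoidalCategory C]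

theorem Spec.id_unit_notMem (p : Spec C) : 𝟙 (𝟙_ C) ∉ p.hom (𝟙_ C) (𝟙_ C) := by
  intro h
  obtain ⟨g, k, r, hr⟩ := p.proper
  exact hr (p.mem_of_unit_mem h r)

/-- The ultraproduct of a family of primes: it consists of the morphisms that lie in almost all
of them. -/
def Spec.ultralimit (l : Ultrafilter (Spec C)) : Spec C where
  hom g h :=
    { carrier := {r | ∀ᶠ p : Spec C in l, r ∈ p.hom g h}
      add_mem' := fun ha hb => by
        filter_upwards [ha, hb] with p hpa hpb using add_mem hpa hpb
      zero_mem' := Eventually.of_forall fun p => zero_mem _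
      neg_mem' := fun ha => by
        filter_upwards [ha] with p hpa using neg_mem hpa }
  comp_mem a r b hr := Eventually.mono hr fun p hp => p.comp_mem a r b hp
  tensor_mem_left s r hr := Eventually.mono hr fun p hp => p.tensor_mem_left s r hp
  tensor_mem_right r s hr := Eventually.mono hr fun p hp => p.tensor_mem_right r s hp
  proper := ⟨𝟙_ C, 𝟙_ C, 𝟙 _, fun h => by
    obtain ⟨p, hp⟩ := Eventually.exists (f := (l : Filter (Spec C))) h
    exact p.id_unit_notMem hp⟩
  mem_or_mem r s hrs :=
    Ultrafilter.eventually_or.1 (Eventually.mono hrs fun p hp => p.mem_or_mem r s hp)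

/-- The set of primes that do not contain a given morphism. -/
def basicOpen (r : Σ g h : C, g ⟶ h) : Set (Spec C) :=
  {p | r.2.2 ∉ p.hom r.1 r.2.1}

variable [SymmetricCategory C] [GradedCommTwoRing C]

theorem isOpen_basicOpen (r : Σ g h : C, g ⟶ h) : IsOpen (basicOpen r) := by
  rw [← isClosed_compl_iff, isClosed_iff_exists_zeroLocus]
  refine ⟨HomogeneousIdeal.sInf {I | r.2.2 ∈ I.hom r.1 r.2.1}, ?_⟩
  ext p
  simp only [basicOpen, Set.mem_compl_iff, Set.mem_ofPred_eq, not_not]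
  constructor
  · intro hp g h s hs
    exact HomogeneousIdeal.mem_sInf.1 hs p.toHomogeneousIdeal hp
  · intro hp
    exact hp _ _ (HomogeneousIdeal.mem_sInf.2 fun I hI => hI)

/-- The complement of `U` is some `V(I)`; as `p` does not contain `I`, any `r` in `I` outside `p`
serves. -/
theorem exists_basicOpen_subset {U : Set (Spec C)} (hU : IsOpen U) {p : Spec C} (hp : p ∈ U) :
    ∃ r : Σ g h : C, g ⟶ h, p ∈ basicOpen r ∧ basicOpen r ⊆ U := by
  obtain ⟨I, hI⟩ := (isClosed_iff_exists_zeroLocus Uᶜ).1 hU.isClosed_compl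
  have hpI : p ∉ zeroLocus I := hI ▸ not_not.2 hp
  simp only [zeroLocus, Set.mem_ofPred_eq, not_forall, SetLike.not_le_iff_exists] at hpI
  obtain ⟨g, h, r, hr, hrp⟩ := hpI
  refine ⟨⟨g, h, r⟩, hrp, fun q hq => ?_⟩
  by_contra hqU
  have hqI : q ∈ zeroLocus I := hI ▸ hqU
  exact hq (hqI g h hr)

theorem isTopologicalBasis_basicOpen :
    TopologicalSpace.IsTopologicalBasis (Set.range (basicOpen (C := C))) := by
  refine TopologicalSpace.isTopologicalBasis_of_isOpen_of_nhds ?_ ?_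
  · rintro _ ⟨r, rfl⟩
    exact isOpen_basicOpen r
  · intro p U hp hU
    obtain ⟨r, hpr, hr⟩ := exists_basicOpen_subset hU hp
    exact ⟨_, ⟨r, rfl⟩, hpr, hr⟩

/-- An ultrafilter converges to its ultraproduct: the latter lies in a basic open set exactly when
that set belongs to the ultrafilter. -/
theorem isCompact_basicOpen (r : Σ g h : C, g ⟶ h) : IsCompact (basicOpen r) := by
  rw [isCompact_iff_ultrafilter_le_nhds']
  intro l hl
  have hmem : ∀ s : Σ g h : C, g ⟶ h, Spec.ultralimit l ∈ basicOpen s ↔ basicOpen s ∈ l :=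
    fun s => Ultrafilter.eventually_not.symm
  refine ⟨Spec.ultralimit l, (hmem r).2 hl, ?_⟩
  intro U hU
  obtain ⟨V, hVU, hV, hlV⟩ := mem_nhds_iff.1 hU
  obtain ⟨s, hs, hsV⟩ := exists_basicOpen_subset hV hlV
  exact mem_of_superset ((hmem s).1 hs) (hsV.trans hVU)

/-- The preimage of the basic open set of `r` is, by definition, that of `F.map r`. -/
theorem isSpectralMap_specMap {D : Type u'} [Category.{v'} D] [Preadditive D]
    [MonoidalCategory D] [SymmetricCategory D] [GradedCommTwoRing D] (F : C ⥤ D) [F.Additive]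
    [F.Monoidal] : IsSpectralMap (Spec.map F) :=
  isSpectralMap_of_isTopologicalBasis isTopologicalBasis_basicOpen
    (fun r => isOpen_basicOpen ⟨_, _, F.map r.2.2⟩)
    (fun r => isCompact_basicOpen ⟨_, _, F.map r.2.2⟩)

end Spectrum

/-! ### Compact basic open sets of the triangular spectrum -/

section TriangularSpectrum

open Filter
open scoped ZeroObject

variable {T : Type u} [Category.{v} T] [Preadditive T] [HasZeroObject T] [HasShift T ℤ]
  [∀ n : ℤ, (shiftFunctor T n).Additive] [Pretriangulated T]
  [MonoidalCategory T]

attribute [local instance] Spc.isTriangulated Spc.thick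

theorem Spc.unit_notMem (P : Spc T) : ¬ P.obj (𝟙_ T) := by
  intro h
  obtain ⟨x, hx⟩ := P.proper
  exact hx (P.obj.prop_of_iso (ρ_ x) (P.tensor_mem x _ h))

theorem Spc.biprod_iff (P : Spc T) (x y : T) : P.obj (x ⊞ y) ↔ P.obj x ∧ P.obj y := by
  constructor
  · intro h
    exact ⟨P.obj.prop_of_retract ⟨biprod.inl, biprod.fst, biprod.inl_fst⟩ h,
      P.obj.prop_of_retract ⟨biprod.inr, biprod.snd, biprod.inr_snd⟩ h⟩
  · rintro ⟨hx, hy⟩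
    exact P.obj.ext_of_isTriangulatedClosed₂ _ (binaryBiproductTriangle_distinguished x y) hx hy

/-- The ultraproduct of a family of primes: it consists of the objects that lie in almost all
of them. -/
def Spc.ultralimit (l : Ultrafilter (Spc T)) : Spc T where
  obj x := ∀ᶠ P : Spc T in l, P.obj x
  isTriangulated :=
    { exists_zero := ⟨0, isZero_zero T, Eventually.of_forall fun P => P.obj.prop_zero⟩
      isStableUnderShiftBy := fun n => ⟨fun x hx => by
        have hx : ∀ᶠ P : Spc T in l, P.obj x := hx
        exact hx.mono fun P hP => P.obj.le_shift n _ hP⟩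
      ext₂' := fun Δ hΔ h1 h3 => ObjectProperty.le_isoClosure _ _ <| by
        have h1 : ∀ᶠ P : Spc T in l, P.obj Δ.obj₁ := h1
        have h3 : ∀ᶠ P : Spc T in l, P.obj Δ.obj₃ := h3
        filter_upwards [h1, h3] with P hP1 hP3
        exact P.obj.ext_of_isTriangulatedClosed₂ _ hΔ hP1 hP3 }
  thick := ⟨fun h hy => Eventually.mono hy fun P hP => P.obj.prop_of_retract h hP⟩
  tensor_mem x y hy := Eventually.mono hy fun P hP => P.tensor_mem x y hP
  proper := ⟨𝟙_ T, fun h => by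
    obtain ⟨P, hP⟩ := Eventually.exists (f := (l : Filter (Spc T))) h
    exact P.unit_notMem hP⟩
  mem_or_mem x y h :=
    Ultrafilter.eventually_or.1 (Eventually.mono h fun P hP => P.mem_or_mem x y hP)

theorem isOpen_setOf_obj (x : T) : IsOpen {P : Spc T | P.obj x} :=
  TopologicalSpace.isOpen_generateFrom_of_mem ⟨x, rfl⟩

/-- Again the ultraproduct is a limit. It suffices to test convergence on the generating sets
`U(y)`, where it holds by construction. -/
theorem isCompact_setOf_obj (x : T) : IsCompact {P : Spc T | P.obj x} := by
  rw [isCompact_iff_ultrafilter_le_nhds']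
  intro l hl
  refine ⟨Spc.ultralimit l, hl, ?_⟩
  rw [TopologicalSpace.nhds_generateFrom]
  refine le_iInf₂ ?_
  rintro _ ⟨hU, y, rfl⟩
  exact le_principal_iff.2 hU

/-- The generating sets already form a basis, since `U(x) ∩ U(y) = U(x ⊞ y)` and `U(0)` is the whole
space. -/
theorem isTopologicalBasis_setOf_obj :
    TopologicalSpace.IsTopologicalBasis (Set.range fun x : T => {P : Spc T | P.obj x}) where
  exists_subset_inter := by
    rintro _ ⟨x, rfl⟩ _ ⟨y, rfl⟩ P ⟨hx, hy⟩
    exact ⟨_, ⟨x ⊞ y, rfl⟩, (P.biprod_iff x y).2 ⟨hx, hy⟩, fun Q hQ => (Q.biprod_iff x y).1 hQ⟩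
  sUnion_eq := by
    refine Set.eq_univ_of_forall fun P => ⟨_, ⟨0, rfl⟩, ?_⟩
    exact P.obj.prop_zero
  eq_generateFrom := by
    have h : (Set.range fun x : T => {P : Spc T | P.obj x}) = {U | ∃ x : T, U = {P | P.obj x}} := by
      ext U
      exact exists_congr fun x => eq_comm
    rw [h]
    rfl

theorem isSpectralMap_spcMap [SymmetricCategory T] {T' : Type u'} [Category.{v'} T']
    [Preadditive T'] [HasZeroObject T'] [HasShift T' ℤ] [∀ n : ℤ, (shiftFunctor T' n).Additive] [Pretriangulated T']
    [MonoidalCategory T'] [SymmetricCategory T'] (F : T ⥤ T') [F.Braided] [F.CommShift ℤ]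
    [F.IsTriangulated] : IsSpectralMap (Spc.map F) :=
  isSpectralMap_of_isTopologicalBasis isTopologicalBasis_setOf_obj
    (fun x => isOpen_setOf_obj (F.obj x)) (fun x => isCompact_setOf_obj (F.obj x))

/-! ### Morphisms inverted modulo a prime -/

theorem Spc.trW_iff_cone (P : Spc T) {x y : T} (f : x ⟶ y) :
    P.obj.trW f ↔ P.obj (cone f) := by
  obtain ⟨i, j, h⟩ := cone_distinguished f
  exact P.obj.trW_iff_of_distinguished _ h

theorem Spc.mem_of_trW_zero (P : Spc T) {x y : T} (h : P.obj.trW (0 : x ⟶ y)) : P.obj x := by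
  rw [Spc.trW_iff_cone] at h
  obtain ⟨i, j, hT⟩ := cone_distinguished (0 : x ⟶ y)
  -- The identity of `x⟦1⟧` is killed by the shifted zero map, so it lifts to the cone and `x⟦1⟧` is
  -- a retract of the cone.
  obtain ⟨s, hs⟩ := Triangle.coyoneda_exact₁ _ hT (𝟙 (x⟦(1 : ℤ)⟧))
    ((Category.id_comp _).trans (Functor.map_zero _ _ _))
  have h1 : P.obj (x⟦(1 : ℤ)⟧) := P.obj.prop_of_retract ⟨s, j, hs.symm⟩ h
  exact (P.obj.prop_shift_iff_of_isStableUnderShift x (1 : ℤ)).1 h1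

theorem Spc.mem_of_invertible_tensor_mem [SymmetricCategory T] (P : Spc T) {g g' x : T}
    (e : g ⊗ g' ≅ 𝟙_ T) (h : P.obj (g ⊗ x)) : P.obj x :=
  P.obj.prop_of_iso ((α_ g' g x).symm ≪≫ whiskerRightIso (β_ g' g ≪≫ e) x ≪≫ λ_ x)
    (P.tensor_mem g' _ h)

variable [TensorTriangulated T]

theorem Spc.trW_whiskerLeft (P : Spc T) (x : T) {y z : T} {f : y ⟶ z} (h : P.obj.trW f) :
    P.obj.trW (x ◁ f) := by
  obtain ⟨w, i, j, hT, hw⟩ := (P.obj.trW_iff f).1 h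
  exact ObjectProperty.trW.mk _ ((tensorLeft x).map_distinguished _ hT) (P.tensor_mem x w hw)

variable [SymmetricCategory T]

theorem Spc.trW_tensorHom (P : Spc T) {x y z w : T} {f : x ⟶ y} {k : z ⟶ w}
    (hf : P.obj.trW f) (hk : P.obj.trW k) : P.obj.trW (f ⊗ₘ k) := by
  have h1 : P.obj.trW (f ▷ z) := by
    have h2 : f ▷ z = (β_ x z).hom ≫ z ◁ f ≫ (β_ y z).inv := by simp
    rw [h2]
    exact P.obj.trW.comp_mem _ _ (P.obj.trW_of_isIso _)
      (P.obj.trW.comp_mem _ _ (P.trW_whiskerLeft z hf) (P.obj.trW_of_isIso _))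
  rw [MonoidalCategory.tensorHom_def]
  exact P.obj.trW.comp_mem _ _ h1 (P.trW_whiskerLeft y hk)

/-- The morphism `t ⊗ t ⊗ x` is inverted modulo `P`; being zero, it forces its source `g ⊗ g ⊗ x`
into `P`, and the invertible factors cancel. -/
theorem Spc.mem_of_tensorHom_tensorHom_id_eq_zero (P : Spc T) {g g' h x : T} (e : g ⊗ g' ≅ 𝟙_ T)
    {t : g ⟶ h} (ht : P.obj.trW t) (h0 : t ⊗ₘ (t ⊗ₘ 𝟙 x) = 0) : P.obj x := by
  have h1 := P.trW_tensorHom ht (P.trW_tensorHom ht (P.obj.trW_of_isIso (𝟙 x)))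
  rw [h0] at h1
  exact P.mem_of_invertible_tensor_mem e (P.mem_of_invertible_tensor_mem e (P.mem_of_trW_zero h1))

/-- If a composite with a morphism between invertible objects is inverted modulo the prime `P`,
then so is that morphism. -/
theorem Spc.trW_of_comp (P : Spc T) {g' g h h' k k' l : T} (ek : k ⊗ k' ≅ 𝟙_ T)
    (eg : g ⊗ g' ≅ 𝟙_ T) (eh : h ⊗ h' ≅ 𝟙_ T) (a : k ⟶ g) (r : g ⟶ h) (b : h ⟶ l)
    (hw : P.obj.trW (a ≫ r ≫ b)) : P.obj.trW r := by
  rw [Spc.trW_iff_cone]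
  -- The square of the composite on `cone r` factors through the square of `r`, which vanishes
  -- there. Only the source `k` has to be cancelled, so `l` may be arbitrary.
  refine P.mem_of_tensorHom_tensorHom_id_eq_zero ek hw ?_
  have h1 : (a ≫ r ≫ b) ⊗ₘ ((a ≫ r ≫ b) ⊗ₘ 𝟙 (cone r)) =
      (a ⊗ₘ (a ⊗ₘ 𝟙 _)) ≫ (r ⊗ₘ (r ⊗ₘ 𝟙 _)) ≫ (b ⊗ₘ (b ⊗ₘ 𝟙 _)) := by
    simp only [tensorHom_comp_tensorHom, Category.comp_id]
  rw [h1, tensorHom_tensorHom_id_cone_eq_zero eg eh]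
  simp

theorem tensorHom_tensorHom_id_tensor_eq_zero {g h x : T} (y : T) {r : g ⟶ h}
    (h0 : r ⊗ₘ (r ⊗ₘ 𝟙 x) = 0) : r ⊗ₘ (r ⊗ₘ 𝟙 (x ⊗ y)) = 0 := by
  have h1 : r ⊗ₘ (r ⊗ₘ 𝟙 (x ⊗ y)) = (g ◁ (α_ g x y).inv ≫ (α_ g (g ⊗ x) y).inv) ≫
      (r ⊗ₘ (r ⊗ₘ 𝟙 x)) ▷ y ≫ ((α_ h (h ⊗ x) y).hom ≫ h ◁ (α_ h x y).hom) := by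
    simp [MonoidalCategory.tensorHom_def]
  rw [h1, h0]
  simp

/-- If a sum of morphisms between invertible objects is inverted modulo the prime `P`, then so is
one of the summands. -/
theorem Spc.trW_of_add (P : Spc T) {g g' h h' : T} (eg : g ⊗ g' ≅ 𝟙_ T) (eh : h ⊗ h' ≅ 𝟙_ T)
    (r s : g ⟶ h) (hw : P.obj.trW (r + s)) : P.obj.trW r ∨ P.obj.trW s := by
  rw [Spc.trW_iff_cone, Spc.trW_iff_cone]
  refine P.mem_or_mem _ _ ?_
  have hr : r ⊗ₘ (r ⊗ₘ 𝟙 (cone r ⊗ cone s)) = 0 :=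
    tensorHom_tensorHom_id_tensor_eq_zero _ (tensorHom_tensorHom_id_cone_eq_zero eg eh r)
  have hs : s ⊗ₘ (s ⊗ₘ 𝟙 (cone r ⊗ cone s)) = 0 := by
    have h2 : s ⊗ₘ (s ⊗ₘ 𝟙 (cone r ⊗ cone s)) = g ◁ (g ◁ (β_ (cone r) (cone s)).hom) ≫
        (s ⊗ₘ (s ⊗ₘ 𝟙 (cone s ⊗ cone r))) ≫ h ◁ (h ◁ (β_ (cone r) (cone s)).inv) := by
      simp only [← id_tensorHom, tensorHom_comp_tensorHom, Category.id_comp, Category.comp_id,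
        Iso.hom_inv_id]
    rw [h2, tensorHom_tensorHom_id_tensor_eq_zero _ (tensorHom_tensorHom_id_cone_eq_zero eg eh s)]
    simp
  -- Among three factors from `{r, s}` one occurs twice, so each of the eight terms vanishes once
  -- the repeated factors are moved next to the cones.
  have h3 : (r + s) ⊗ₘ ((r + s) ⊗ₘ ((r + s) ⊗ₘ 𝟙 (cone r ⊗ cone s))) = 0 := by
    have hrsr := tensorHom_left_comm_eq_zero (a := s) (b := r)
      (c := r ⊗ₘ 𝟙 (cone r ⊗ cone s)) (by rw [hr]; simp)
    have hsrs := tensorHom_left_comm_eq_zero (a := r) (b := s)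
      (c := s ⊗ₘ 𝟙 (cone r ⊗ cone s)) (by rw [hs]; simp)
    have hrrs := tensorHom_tensorHom_left_comm_eq_zero hrsr
    have hssr := tensorHom_tensorHom_left_comm_eq_zero hsrs
    simp only [MonoidalPreadditive.tensor_add, MonoidalPreadditive.add_tensor, hr, hs, hrsr, hsrs,
      hrrs, hssr, MonoidalPreadditive.tensor_zero, add_zero]
  have h4 := P.trW_tensorHom hw
    (P.trW_tensorHom hw (P.trW_tensorHom hw (P.obj.trW_of_isIso (𝟙 (cone r ⊗ cone s)))))
  rw [h3] at h4
  exact P.mem_of_invertible_tensor_mem eg (P.mem_of_invertible_tensor_mem eg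
    (P.mem_of_invertible_tensor_mem eg (P.mem_of_trW_zero h4)))

/-- If a tensor product with a morphism between invertible objects is inverted modulo `P`, then
so is that morphism. -/
theorem Spc.trW_of_tensorHom (P : Spc T) {k k' l g g' h h' : T} (ek : k ⊗ k' ≅ 𝟙_ T)
    (eg : g ⊗ g' ≅ 𝟙_ T) (eh : h ⊗ h' ≅ 𝟙_ T) (s : k ⟶ l) (r : g ⟶ h)
    (hw : P.obj.trW (s ⊗ₘ r)) : P.obj.trW r := by
  let e : k' ⊗ k ≅ 𝟙_ T := β_ k' k ≪≫ ek
  let a (x : T) : x ≅ k' ⊗ (k ⊗ x) := (λ_ x).symm ≪≫ whiskerRightIso e.symm x ≪≫ α_ k' k x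
  have ha : (a g).hom ≫ k' ◁ (k ◁ r) = r ≫ (a h).hom := by
    simp only [a, Iso.trans_hom, Iso.symm_hom, whiskerRightIso_hom, Category.assoc]
    rw [← associator_naturality_right, ← whisker_exchange_assoc, ← leftUnitor_inv_naturality_assoc]
  -- Identifying `x` with `k' ⊗ (k ⊗ x)` turns `k' ◁ (s ⊗ₘ r)` into `r` followed by a map induced by
  -- `s`, so `r` is a factor of an inverted morphism.
  refine P.trW_of_comp eg eg eh (𝟙 g) r ((a h).hom ≫ k' ◁ (s ▷ h)) ?_
  have h1 : 𝟙 g ≫ r ≫ (a h).hom ≫ k' ◁ (s ▷ h) = (a g).hom ≫ k' ◁ (s ⊗ₘ r) := by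
    rw [tensorHom_def', MonoidalCategory.whiskerLeft_comp, reassoc_of% ha, Category.id_comp]
  rw [h1]
  exact P.obj.trW.comp_mem _ _ (P.obj.trW_of_isIso _) (P.trW_whiskerLeft k' hw)

/-! ### The comparison map and its naturality -/

variable (R : ObjectProperty T) [IsCentralTwoRing R]

/-- The comparison map, `P ↦ {r ∈ Mor R | cone r ∉ P}`. -/
def comparisonMap (P : Spc T) : Spec R.FullSubcategory where
  hom g h :=
    { carrier := {r | ¬ P.obj.trW r.hom}
      add_mem' := by
        intro r s hr hs hrs
        obtain ⟨g', ⟨eg⟩⟩ := IsCentralTwoRing.invertible g.obj g.property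
        obtain ⟨h', ⟨eh⟩⟩ := IsCentralTwoRing.invertible h.obj h.property
        exact (P.trW_of_add eg eh r.hom s.hom hrs).elim hr hs
      zero_mem' := by
        -- If zero were inverted, its invertible source, and hence the unit, would lie in `P`.
        intro h0
        obtain ⟨g', ⟨eg⟩⟩ := IsCentralTwoRing.invertible g.obj g.property
        have hg : P.obj (g.obj ⊗ 𝟙_ T) :=
          P.obj.prop_of_iso (ρ_ g.obj).symm (P.mem_of_trW_zero h0)
        exact P.unit_notMem (P.mem_of_invertible_tensor_mem eg hg)
      neg_mem' := by
        intro r hr hn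
        refine hr ((P.obj.smul_mem_trW_iff r.hom (-1)).1 ?_)
        have h1 : (-1 : ℤˣ) • r.hom = (-r).hom := by
          rw [Units.neg_smul, one_smul]
          rfl
        rw [h1]
        exact hn }
  comp_mem {g' g h h'} a r b hr hn := by
    obtain ⟨k, ⟨ek⟩⟩ := IsCentralTwoRing.invertible g'.obj g'.property
    obtain ⟨k', ⟨eg⟩⟩ := IsCentralTwoRing.invertible g.obj g.property
    obtain ⟨k'', ⟨eh⟩⟩ := IsCentralTwoRing.invertible h.obj h.property
    exact hr (P.trW_of_comp ek eg eh a.hom r.hom b.hom hn)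
  tensor_mem_left {k l g h} s r hr hn := by
    obtain ⟨k', ⟨ek⟩⟩ := IsCentralTwoRing.invertible k.obj k.property
    obtain ⟨g', ⟨eg⟩⟩ := IsCentralTwoRing.invertible g.obj g.property
    obtain ⟨h', ⟨eh⟩⟩ := IsCentralTwoRing.invertible h.obj h.property
    exact hr (P.trW_of_tensorHom ek eg eh s.hom r.hom hn)
  tensor_mem_right {g h k l} r s hr hn := by
    obtain ⟨k', ⟨ek⟩⟩ := IsCentralTwoRing.invertible k.obj k.property
    obtain ⟨g', ⟨eg⟩⟩ := IsCentralTwoRing.invertible g.obj g.property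
    obtain ⟨h', ⟨eh⟩⟩ := IsCentralTwoRing.invertible h.obj h.property
    refine hr (P.trW_of_tensorHom ek eg eh s.hom r.hom ?_)
    have h1 : s.hom ⊗ₘ r.hom = (β_ k.obj g.obj).hom ≫ (r.hom ⊗ₘ s.hom) ≫ (β_ l.obj h.obj).inv := by
      rw [← BraidedCategory.braiding_naturality_assoc, Iso.hom_inv_id, Category.comp_id]
    rw [h1]
    exact P.obj.trW.comp_mem _ _ (P.obj.trW_of_isIso _)
      (P.obj.trW.comp_mem _ _ hn (P.obj.trW_of_isIso _))
  proper := ⟨𝟙_ _, 𝟙_ _, 𝟙 _, fun h => h (P.obj.trW_of_isIso (𝟙 (𝟙_ T)))⟩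
  mem_or_mem r s hrs := by
    by_contra hcon
    obtain ⟨hr, hs⟩ := not_or.1 hcon
    exact hrs (P.obj.trW.comp_mem _ _ (not_not.1 hr) (not_not.1 hs))

theorem isComparisonMap_comparisonMap : IsComparisonMap R (comparisonMap R) :=
  fun P _ _ r => (P.trW_iff_cone r.hom).not

/-- The preimage of the basic open set of `r` is `U(cone r)`, which is compact open. -/
theorem isSpectralMap_comparisonMap : IsSpectralMap (comparisonMap R) := by
  have h : ∀ r : Σ g h : R.FullSubcategory, g ⟶ h,
      comparisonMap R ⁻¹' basicOpen r = {P : Spc T | P.obj (cone r.2.2.hom)} := fun r => by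
    ext P
    exact (isComparisonMap_comparisonMap R P _ _ r.2.2).not.trans not_not
  refine isSpectralMap_of_isTopologicalBasis isTopologicalBasis_basicOpen (fun r => ?_) fun r => ?_
  · rw [h]
    exact isOpen_setOf_obj _
  · rw [h]
    exact isCompact_setOf_obj _

/-- By exactness of `F`, a morphism is inverted modulo `F⁻¹ P` exactly when its image is inverted
modulo `P`. -/
theorem comparisonMap_comp_spcMap {T' : Type u'} [Category.{v'} T'] [Preadditive T']
    [HasZeroObject T'] [HasShift T' ℤ] [∀ n : ℤ, (shiftFunctor T' n).Additive]
    [Pretriangulated T'] [MonoidalCategory T'] [SymmetricCategory T'] [TensorTriangulated T']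
    (R' : ObjectProperty T') [IsCentralTwoRing R'] (F : T ⥤ T') [F.Braided] [F.CommShift ℤ]
    [F.IsTriangulated] (hF : ∀ g : T, R g → R' (F.obj g)) :
    comparisonMap R ∘ Spc.map F = Spec.map (restrict R R' F hF) ∘ comparisonMap R' := by
  funext P
  refine Spec.ext ?_
  funext g h
  ext r
  exact (P.obj.inverseImage_trW_iff F r.hom).not

end TriangularSpectrum

end TTGeometry

theorem mainTheorem1
    {T : Type u} [Category.{v} T] [Preadditive T] [HasZeroObject T] [HasShift T ℤ]
    [∀ n : ℤ, (shiftFunctor T n).Additive] [Pretriangulated T]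
    [MonoidalCategory T] [SymmetricCategory T] [TTGeometry.TensorTriangulated T]
    (R : ObjectProperty T) [TTGeometry.IsCentralTwoRing R] :
    ∃ ρ : TTGeometry.Spc T → TTGeometry.Spec R.FullSubcategory,
      IsSpectralMap ρ ∧ TTGeometry.IsComparisonMap R ρ ∧
      ∀ {T' : Type u'} [Category.{v'} T'] [Preadditive T'] [HasZeroObject T'] [HasShift T' ℤ]
        [∀ n : ℤ, (shiftFunctor T' n).Additive] [Pretriangulated T']
        [MonoidalCategory T'] [SymmetricCategory T'] [TTGeometry.TensorTriangulated T']
        (R' : ObjectProperty T') [TTGeometry.IsCentralTwoRing R']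
        (F : T ⥤ T') [F.Braided] [F.CommShift ℤ] [F.IsTriangulated]
        (hF : ∀ g : T, R g → R' (F.obj g)),
        IsSpectralMap (TTGeometry.Spc.map F) ∧
        IsSpectralMap (TTGeometry.Spec.map (TTGeometry.restrict R R' F hF)) ∧
        ∃ ρ' : TTGeometry.Spc T' → TTGeometry.Spec R'.FullSubcategory,
          IsSpectralMap ρ' ∧ TTGeometry.IsComparisonMap R' ρ' ∧
          ρ ∘ TTGeometry.Spc.map F =
            TTGeometry.Spec.map (TTGeometry.restrict R R' F hF) ∘ ρ' :=
  ⟨TTGeometry.comparisonMap R, TTGeometry.isSpectralMap_comparisonMap R,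
    TTGeometry.isComparisonMap_comparisonMap R, fun R' _ F _ _ _ hF =>
      ⟨TTGeometry.isSpectralMap_spcMap F, TTGeometry.isSpectralMap_specMap _,
        TTGeometry.comparisonMap R', TTGeometry.isSpectralMap_comparisonMap R',
        TTGeometry.isComparisonMap_comparisonMap R',
        TTGeometry.comparisonMap_comp_spcMap R R' F hF⟩⟩
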